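/- Let $M$ be a closed (compact, without boundary) connected smooth manifold of dimension $n\ge 0$. Let $\mathcal R(M)$ be the set of smooth Riemannian metrics on $M$, and let $\mathcal M(M)=\mathcal R(M)/\mathrm{Diff}(M)$ be the moduli space, where two metrics $g_1,g_2$ are identified when $g_1=\varphi^*g_2$ for some diffeomorphism $\varphi$ of $M$. Equip $\mathcal M(M)$ with the Gromov–Hausdorff topology, i.e. the topology of the distance $$\rho_{GH}([g_1],[g_2])=\rho_{GH}\big((M,d_{g_1}),(M,d_{g_2})\big),$$ where $d_{g}$ is the Riemannian distance of $g$ and $\rho_{GH}$ on the right is the Gromov–Hausdorff distance between compact metric spaces. Then for every $g\in\mathcal R(M)$ the conformal class of $g$ in the moduli space, $$\{[f g] : f\in C^\infty(M),\ f>0\}\subseteq \mathcal M(M),$$ is dense in $\mathcal M(M)$. -/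

import Mathlib

open scoped Manifold ContDiff Bundle ENNReal

noncomputable section

namespace ConformalDensity

section Metrics

variable (n : ℕ) (M : Type*) [TopologicalSpace M] [ChartedSpace (EuclideanSpace ℝ (Fin n)) M]
  [IsManifold (𝓡 n) ∞ M]

/-- The space `R(M)` of smooth Riemannian metrics on the smooth `n`-manifold `M`. -/
abbrev RiemMetric : Type _ :=
  Bundle.ContMDiffRiemannianMetric (𝓡 n) ∞ (EuclideanSpace ℝ (Fin n))
    (fun x : M => TangentSpace (𝓡 n) x)

variable {n M}

/-- The diffeomorphism `φ` satisfies `g₁ = φ^* g₂`, that is,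
`g₁(v, w) = g₂(dφ v, dφ w)` for all tangent vectors `v, w` at all points. -/
def IsPullback (φ : Diffeomorph (𝓡 n) (𝓡 n) M M ∞) (g₁ g₂ : RiemMetric n M) : Prop :=
  ∀ (x : M) (v w : TangentSpace (𝓡 n) x),
    g₁.inner x v w =
      g₂.inner (φ x) (mfderiv (𝓡 n) (𝓡 n) φ x v) (mfderiv (𝓡 n) (𝓡 n) φ x w)

/-- `g'` is pointwise conformal to `g`: one has `g' = f g` with `f` smooth and positive. -/
def IsConformal (g g' : RiemMetric n M) : Prop :=
  ∃ f : M → ℝ, ContMDiff (𝓡 n) 𝓘(ℝ, ℝ) ∞ f ∧ (∀ x, 0 < f x) ∧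
    ∀ (x : M) (v w : TangentSpace (𝓡 n) x), g'.inner x v w = f x * g.inner x v w

theorem IsPullback.refl (g : RiemMetric n M) :
    IsPullback (Diffeomorph.refl (𝓡 n) M ∞) g g := by
  intro x v w
  rw [Diffeomorph.coe_refl, mfderiv_id]
  rfl

theorem IsPullback.trans {φ ψ : Diffeomorph (𝓡 n) (𝓡 n) M M ∞} {g₁ g₂ g₃ : RiemMetric n M}
    (h : IsPullback φ g₁ g₂) (h' : IsPullback ψ g₂ g₃) : IsPullback (φ.trans ψ) g₁ g₃ := by
  intro x v w
  have e : mfderiv (𝓡 n) (𝓡 n) (φ.trans ψ) x =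
      (mfderiv (𝓡 n) (𝓡 n) ψ (φ x)).comp (mfderiv (𝓡 n) (𝓡 n) φ x) := by
    rw [Diffeomorph.coe_trans]
    exact mfderiv_comp x (ψ.mdifferentiable (by simp) (φ x)) (φ.mdifferentiable (by simp) x)
  rw [h x v w, h' (φ x), e]
  rfl

theorem IsPullback.symm {φ : Diffeomorph (𝓡 n) (𝓡 n) M M ∞} {g₁ g₂ : RiemMetric n M}
    (h : IsPullback φ g₁ g₂) : IsPullback φ.symm g₂ g₁ := by
  intro y v w
  have e : (mfderiv (𝓡 n) (𝓡 n) φ (φ.symm y)).comp (mfderiv (𝓡 n) (𝓡 n) φ.symm y) =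
      mfderiv (𝓡 n) (𝓡 n) (φ ∘ φ.symm) y :=
    (mfderiv_comp y (φ.mdifferentiable (by simp) (φ.symm y))
      (φ.symm.mdifferentiable (by simp) y)).symm
  have key : ∀ (z : M) (hz : z = y) (ψ : M → M), ψ = id → ∀ A : TangentSpace (𝓡 n) y →L[ℝ]
      TangentSpace (𝓡 n) z, HEq A (mfderiv (𝓡 n) (𝓡 n) ψ y) →
      g₂.inner y v w = g₂.inner z (A v) (A w) := by
    intro z hz ψ hψ A hA
    subst hz hψ
    rw [eq_of_heq hA, mfderiv_id]
    rfl
  rw [h (φ.symm y)]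
  exact key (φ (φ.symm y)) (φ.apply_symm_apply y) (φ ∘ φ.symm)
    (funext fun z => φ.apply_symm_apply z) _ (heq_of_eq e)

variable (n M) in
/-- Two metrics are equivalent when they lie in the same orbit of the diffeomorphism group. -/
def moduliSetoid : Setoid (RiemMetric n M) where
  r g₁ g₂ := ∃ φ : Diffeomorph (𝓡 n) (𝓡 n) M M ∞, IsPullback φ g₁ g₂
  iseqv :=
    { refl := fun g => ⟨_, IsPullback.refl g⟩
      symm := fun ⟨_, h⟩ => ⟨_, h.symm⟩
      trans := fun ⟨_, h⟩ ⟨_, h'⟩ => ⟨_, h.trans h'⟩ }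

variable (n M) in
/-- The moduli space `R(M) / Diff(M)`. -/
def ModuliSpace : Type _ := Quotient (moduliSetoid n M)

/-- The class of a Riemannian metric in the moduli space. -/
def ModuliSpace.mk (g : RiemMetric n M) : ModuliSpace n M := Quotient.mk (moduliSetoid n M) g

/-- The conformal class of `g`, as a subset of the moduli space. -/
def conformalClass (g : RiemMetric n M) : Set (ModuliSpace n M) :=
  ModuliSpace.mk '' {g' | IsConformal g g'}

/-- The Riemannian distance of `g`: the infimum of the `g`-lengths of `C^1` paths. -/
def riemEDist (g : RiemMetric n M) (x y : M) : ℝ≥0∞ :=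
  letI : Bundle.RiemannianBundle (fun x : M => TangentSpace (𝓡 n) x) := ⟨g.toRiemannianMetric⟩
  Manifold.riemannianEDist (𝓡 n) x y

/-- The manifold `M` with the Riemannian distance of `g`, as an extended metric space;
its topology is the given one. -/
@[reducible] def riemEMetricSpace [T3Space M] (g : RiemMetric n M) : EMetricSpace M :=
  letI : Bundle.RiemannianBundle (fun x : M => TangentSpace (𝓡 n) x) := ⟨g.toRiemannianMetric⟩
  haveI : IsContinuousRiemannianBundle (EuclideanSpace ℝ (Fin n))
      (fun x : M => TangentSpace (𝓡 n) x) := ⟨g.inner, g.contMDiff.continuous, fun _ _ _ => rfl⟩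
  EMetricSpace.ofRiemannianMetric (𝓡 n) M

theorem riemEMetricSpace_topology [T3Space M] (g : RiemMetric n M) :
    (riemEMetricSpace g).toUniformSpace.toTopologicalSpace = ‹TopologicalSpace M› := rfl

theorem riemEDist_le_of_isPullback {φ : Diffeomorph (𝓡 n) (𝓡 n) M M ∞} {g₁ g₂ : RiemMetric n M}
    (h : IsPullback φ g₁ g₂) (x y : M) : riemEDist g₂ (φ x) (φ y) ≤ riemEDist g₁ x y := by
  let b₁ : Bundle.RiemannianBundle (fun x : M => TangentSpace (𝓡 n) x) := ⟨g₁.toRiemannianMetric⟩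
  let b₂ : Bundle.RiemannianBundle (fun x : M => TangentSpace (𝓡 n) x) := ⟨g₂.toRiemannianMetric⟩
  have en (z : M) (v : TangentSpace (𝓡 n) z) :
      (letI := b₂; ‖mfderiv (𝓡 n) (𝓡 n) φ z v‖ₑ) = (letI := b₁; ‖v‖ₑ) := by
    have e₁ : (letI := b₁; ‖v‖ₑ) = ENNReal.ofReal (√(g₁.inner z v v)) := by
      let _ := b₁
      exact (ofReal_norm v).symm.trans (congrArg ENNReal.ofReal (norm_eq_sqrt_real_inner v))
    have e₂ (w : TangentSpace (𝓡 n) (φ z)) :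
        (letI := b₂; ‖w‖ₑ) = ENNReal.ofReal (√(g₂.inner (φ z) w w)) := by
      let _ := b₂
      exact (ofReal_norm w).symm.trans (congrArg ENNReal.ofReal (norm_eq_sqrt_real_inner w))
    exact (e₂ _).trans (by rw [← h, e₁])
  unfold riemEDist
  rw [Manifold.riemannianEDist, Manifold.riemannianEDist]
  refine le_iInf₂ fun γ hγ => ?_
  have hs : ContMDiff (𝓡∂ 1) (𝓡 n) 1 (γ.map φ.continuous) :=
    (φ.contMDiff.of_le (by simp)).comp hγ
  refine (iInf₂_le (γ.map φ.continuous) hs).trans (le_of_eq ?_)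
  refine MeasureTheory.lintegral_congr fun t => ?_
  have hc : mfderiv (𝓡∂ 1) (𝓡 n) (φ ∘ γ) t =
      (mfderiv (𝓡 n) (𝓡 n) φ (γ t)).comp (mfderiv (𝓡∂ 1) (𝓡 n) γ t) :=
    mfderiv_comp t (φ.mdifferentiable (by simp) (γ t)) (hγ.mdifferentiable (by simp) t)
  refine Eq.trans ?_ (en (γ t) (mfderiv (𝓡∂ 1) (𝓡 n) γ t 1))
  have hc' := congrArg (fun A => A 1) hc
  exact congrArg (fun v : TangentSpace (𝓡 n) (φ (γ t)) => (letI := b₂; ‖v‖ₑ)) hc'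

end Metrics

section Closed

variable {n : ℕ} {M : Type*} [TopologicalSpace M] [ChartedSpace (EuclideanSpace ℝ (Fin n)) M]
  [IsManifold (𝓡 n) ∞ M] [T2Space M] [CompactSpace M] [ConnectedSpace M]

theorem riemEDist_ne_top (g : RiemMetric n M) (x y : M) : riemEDist g x y ≠ ⊤ := by
  have hc : @ConnectedSpace M (riemEMetricSpace g).toUniformSpace.toTopologicalSpace :=
    ‹ConnectedSpace M›
  let e := riemEMetricSpace g
  have h : @Metric.eball M e.toEDist x ⊤ = Set.univ :=
    @IsClopen.eq_univ M e.toUniformSpace.toTopologicalSpace hc.toPreconnectedSpace _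
      ⟨@Metric.isClosed_eball_top M e.toPseudoEMetricSpace x,
        @Metric.isOpen_eball M e.toPseudoEMetricSpace x ⊤⟩
      ⟨x, @Metric.mem_eball_self M e.toPseudoEMetricSpace x ⊤ ENNReal.zero_lt_top⟩
  have hy : y ∈ @Metric.eball M e.toEDist x ⊤ := h ▸ Set.mem_univ y
  have hy' : @edist M e.toEDist x y < ⊤ := @Metric.mem_eball' M e.toPseudoEMetricSpace x y ⊤ |>.1 hy
  exact hy'.ne

/-- The metric space `(M, d_g)`; its topology is the given one. -/
@[reducible] def riemMetricSpace (g : RiemMetric n M) : MetricSpace M :=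
  @EMetricSpace.toMetricSpace M (riemEMetricSpace g) (riemEDist_ne_top g)

theorem compactSpace_riemMetricSpace (g : RiemMetric n M) :
    @CompactSpace M (riemMetricSpace g).toUniformSpace.toTopologicalSpace := ‹CompactSpace M›

/-- The isometry class of `(M, d_g)`, a point of the Gromov-Hausdorff space. -/
def toGH (g : RiemMetric n M) : GromovHausdorff.GHSpace :=
  @GromovHausdorff.toGHSpace M (riemMetricSpace g) (compactSpace_riemMetricSpace g) inferInstance

theorem toGH_eq_of_isPullback {φ : Diffeomorph (𝓡 n) (𝓡 n) M M ∞} {g₁ g₂ : RiemMetric n M}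
    (h : IsPullback φ g₁ g₂) : toGH g₁ = toGH g₂ := by
  have hd : ∀ x y, riemEDist g₂ (φ x) (φ y) = riemEDist g₁ x y := fun x y =>
    le_antisymm (riemEDist_le_of_isPullback h x y) (by
      simpa using riemEDist_le_of_isPullback h.symm (φ x) (φ y))
  exact (@GromovHausdorff.toGHSpace_eq_toGHSpace_iff_isometryEquiv M (riemMetricSpace g₁)
    (compactSpace_riemMetricSpace g₁) _ M (riemMetricSpace g₂)
    (compactSpace_riemMetricSpace g₂) _).2
    ⟨@IsometryEquiv.mk M M (riemMetricSpace g₁).toPseudoEMetricSpace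
      (riemMetricSpace g₂).toPseudoEMetricSpace φ.toEquiv hd⟩

/-- The isometry class of `(M, d_g)` depends only on the class of `g` in the moduli space. -/
def ModuliSpace.toGH : ModuliSpace n M → GromovHausdorff.GHSpace :=
  Quotient.lift ConformalDensity.toGH fun _ _ ⟨_, h⟩ => toGH_eq_of_isPullback h

/-- The moduli space carries the Gromov-Hausdorff distance
`ρ([g₁], [g₂]) = ρ_GH((M, d_{g₁}), (M, d_{g₂}))` and the topology of this distance. -/
instance : PseudoMetricSpace (ModuliSpace n M) :=
  PseudoMetricSpace.induced ModuliSpace.toGH inferInstance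

theorem ModuliSpace.dist_mk (g₁ g₂ : RiemMetric n M) :
    dist (ModuliSpace.mk g₁) (ModuliSpace.mk g₂) =
      @GromovHausdorff.ghDist M M (riemMetricSpace g₁) _ (compactSpace_riemMetricSpace g₁)
        (riemMetricSpace g₂) _ (compactSpace_riemMetricSpace g₂) := rfl

end Closed

end ConformalDensity

end

/-! Given a target metric `h`, pick `C` with `|v|_h ≤ C |v|_g` and a finite net of `M`, and join its
points by almost `h`-minimal `C^1` paths. The metric wanted is `w ^ 2 g`, with `w` about `|γ'|_h /
|γ'|_g` along these paths and allowed to be as large as `C` elsewhere. Then the chosen paths keep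
almost their `h`-length, so distances on the net do not grow much.

The danger is a shortcut that mixes pieces of several paths or runs beside them. It is excluded
because a `C^1` path is infinitesimally minimizing: on a short piece `K` of it, `d_h ≤ ρ d_g` holds
between any two points, with `ρ` almost the ratio of speeds (`exists_local_ratio`). Moving near `K`
at cost `ρ |·|_g` therefore never beats `d_h` by more than a small error. Finitely many pieces
suffice, and `riemEDist_le_length_add` bounds the total error in terms of their number alone,
however often a curve switches between them. No general position of the paths is needed.

`exists_smooth_weight` produces `w`. The bound `w ≤ C` makes the same finite set a fine net for `g`,
`h` and `w ^ 2 g` alike, and Gromov–Hausdorff closeness follows. -/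

noncomputable section

namespace ConformalDensity

open Set Filter MeasureTheory Topology

/-! ### Lengths of paths and the Riemannian distance. -/

section Length

variable {n : ℕ} {M : Type*} [TopologicalSpace M] [ChartedSpace (EuclideanSpace ℝ (Fin n)) M]
  [IsManifold (𝓡 n) ∞ M]

/-- The norm of a tangent vector with respect to a Riemannian metric. -/
def gnorm (g : RiemMetric n M) (x : M) (v : TangentSpace (𝓡 n) x) : ℝ := √(g.inner x v v)

/-- The velocity of a path. -/
def velocity (γ : ℝ → M) (t : ℝ) : TangentSpace (𝓡 n) (γ t) := mfderiv 𝓘(ℝ, ℝ) (𝓡 n) γ t (1 : ℝ)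

/-- The speed of a path with respect to a Riemannian metric. -/
def speed (g : RiemMetric n M) (γ : ℝ → M) (t : ℝ) : ℝ := gnorm g (γ t) (velocity γ t)

/-- The length of a path with respect to a Riemannian metric. -/
def length (g : RiemMetric n M) (γ : ℝ → M) (a b : ℝ) : ℝ≥0∞ :=
  ∫⁻ t in Icc a b, ENNReal.ofReal (speed g γ t)

theorem gnorm_nonneg (g : RiemMetric n M) (x : M) (v : TangentSpace (𝓡 n) x) : 0 ≤ gnorm g x v :=
  Real.sqrt_nonneg _

theorem speed_nonneg (g : RiemMetric n M) (γ : ℝ → M) (t : ℝ) : 0 ≤ speed g γ t :=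
  gnorm_nonneg _ _ _

theorem inner_self_nonneg (g : RiemMetric n M) (x : M) (v : TangentSpace (𝓡 n) x) :
    0 ≤ g.inner x v v := by
  by_cases hv : v = 0
  · simp [hv]
  · exact (g.pos x v hv).le

theorem gnorm_sq (g : RiemMetric n M) (x : M) (v : TangentSpace (𝓡 n) x) :
    gnorm g x v ^ 2 = g.inner x v v :=
  Real.sq_sqrt (inner_self_nonneg g x v)

theorem pathELength_eq_length (g : RiemMetric n M) (γ : ℝ → M) (a b : ℝ) :
    letI : Bundle.RiemannianBundle (fun x : M => TangentSpace (𝓡 n) x) := ⟨g.toRiemannianMetric⟩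
    Manifold.pathELength (𝓡 n) γ a b = length g γ a b := by
  let b₁ : Bundle.RiemannianBundle (fun x : M => TangentSpace (𝓡 n) x) := ⟨g.toRiemannianMetric⟩
  rw [Manifold.pathELength_eq_lintegral_mfderiv_Icc]
  exact lintegral_congr fun t => (ofReal_norm _).symm.trans
    (congrArg ENNReal.ofReal (norm_eq_sqrt_real_inner _))

theorem riemEDist_le_length (g : RiemMetric n M) {γ : ℝ → M} {a b : ℝ}
    (hγ : ContMDiff 𝓘(ℝ, ℝ) (𝓡 n) 1 γ) (hab : a ≤ b) :
    riemEDist g (γ a) (γ b) ≤ length g γ a b := by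
  rw [← pathELength_eq_length]
  let b₁ : Bundle.RiemannianBundle (fun x : M => TangentSpace (𝓡 n) x) := ⟨g.toRiemannianMetric⟩
  exact Manifold.riemannianEDist_le_pathELength hγ.contMDiffOn rfl rfl hab

theorem exists_length_lt (g : RiemMetric n M) {x y : M} {r : ℝ≥0∞} (h : riemEDist g x y < r) :
    ∃ γ : ℝ → M, γ 0 = x ∧ γ 1 = y ∧ ContMDiff 𝓘(ℝ, ℝ) (𝓡 n) 1 γ ∧ length g γ 0 1 < r := by
  let b₁ : Bundle.RiemannianBundle (fun x : M => TangentSpace (𝓡 n) x) := ⟨g.toRiemannianMetric⟩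
  obtain ⟨γ, h0, h1, hγ, hl, -⟩ :=
    Manifold.exists_lt_locally_constant_of_riemannianEDist_lt (I := 𝓡 n) h zero_lt_one
  refine ⟨γ, h0, h1, hγ, ?_⟩
  rw [← pathELength_eq_length]
  exact hl

theorem riemEDist_self (g : RiemMetric n M) (x : M) : riemEDist g x x = 0 := by
  let b₁ : Bundle.RiemannianBundle (fun x : M => TangentSpace (𝓡 n) x) := ⟨g.toRiemannianMetric⟩
  exact Manifold.riemannianEDist_self

theorem riemEDist_comm (g : RiemMetric n M) (x y : M) : riemEDist g x y = riemEDist g y x := by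
  let b₁ : Bundle.RiemannianBundle (fun x : M => TangentSpace (𝓡 n) x) := ⟨g.toRiemannianMetric⟩
  exact Manifold.riemannianEDist_comm

theorem riemEDist_triangle (g : RiemMetric n M) (x y z : M) :
    riemEDist g x z ≤ riemEDist g x y + riemEDist g y z := by
  let b₁ : Bundle.RiemannianBundle (fun x : M => TangentSpace (𝓡 n) x) := ⟨g.toRiemannianMetric⟩
  exact Manifold.riemannianEDist_triangle

theorem continuous_riemEDist [T3Space M] (g : RiemMetric n M) :
    Continuous fun p : M × M => riemEDist g p.1 p.2 :=
  @continuous_edist M (riemEMetricSpace g).toPseudoEMetricSpace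

theorem length_add (g : RiemMetric n M) (γ : ℝ → M) {a b c : ℝ} (h : a ≤ b) (h' : b ≤ c) :
    length g γ a b + length g γ b c = length g γ a c := by
  rw [← pathELength_eq_length, ← pathELength_eq_length, ← pathELength_eq_length]
  let b₁ : Bundle.RiemannianBundle (fun x : M => TangentSpace (𝓡 n) x) := ⟨g.toRiemannianMetric⟩
  exact Manifold.pathELength_add h h'

theorem length_mono (g : RiemMetric n M) (γ : ℝ → M) {a b a' b' : ℝ} (h : a' ≤ a) (h' : b ≤ b') :
    length g γ a b ≤ length g γ a' b' :=
  lintegral_mono_set (Icc_subset_Icc h h')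

theorem mul_length_le {g g' : RiemMetric n M} {γ : ℝ → M} {a b c : ℝ} (hc : 0 ≤ c)
    (h : ∀ t ∈ Ioo a b, c * speed g γ t ≤ speed g' γ t) :
    ENNReal.ofReal c * length g γ a b ≤ length g' γ a b := by
  unfold length
  rw [← restrict_Ioo_eq_restrict_Icc, ← lintegral_const_mul' _ _ ENNReal.ofReal_ne_top]
  refine setLIntegral_mono' measurableSet_Ioo fun t ht => ?_
  rw [← ENNReal.ofReal_mul hc]
  exact ENNReal.ofReal_le_ofReal (h t ht)

theorem riemEDist_le_mul {g h : RiemMetric n M} {C : ℝ} (hC : 0 < C)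
    (H : ∀ x v, gnorm h x v ≤ C * gnorm g x v) (x y : M) :
    riemEDist h x y ≤ ENNReal.ofReal C * riemEDist g x y := by
  have hC0 : ENNReal.ofReal C ≠ 0 := by simpa using hC
  rw [mul_comm, ← ENNReal.div_le_iff_le_mul (.inl hC0) (.inl ENNReal.ofReal_ne_top)]
  refine le_of_forall_gt fun r hr => ?_
  obtain ⟨γ, rfl, rfl, hγ, hl⟩ := exists_length_lt g hr
  refine lt_of_le_of_lt ?_ hl
  rw [ENNReal.div_le_iff_le_mul (.inl hC0) (.inl ENNReal.ofReal_ne_top), mul_comm]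
  refine (riemEDist_le_length h hγ zero_le_one).trans ?_
  rw [length, length, ← lintegral_const_mul' _ _ ENNReal.ofReal_ne_top]
  refine lintegral_mono fun t => ?_
  rw [← ENNReal.ofReal_mul hC.le]
  exact ENNReal.ofReal_le_ofReal (H _ _)

theorem continuous_speed (g : RiemMetric n M) {γ : ℝ → M} (hγ : ContMDiff 𝓘(ℝ, ℝ) (𝓡 n) 1 γ) :
    Continuous (speed g γ) := by
  let b₁ : Bundle.RiemannianBundle (fun x : M => TangentSpace (𝓡 n) x) := ⟨g.toRiemannianMetric⟩
  have : IsContinuousRiemannianBundle (EuclideanSpace ℝ (Fin n))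
      (fun x : M => TangentSpace (𝓡 n) x) := ⟨g.inner, g.contMDiff.continuous, fun _ _ _ => rfl⟩
  have h1 : Continuous (tangentMap 𝓘(ℝ, ℝ) (𝓡 n) γ) :=
    hγ.continuous_tangentMap le_rfl
  have h2 : Continuous (fun t : ℝ => (⟨t, (1 : ℝ)⟩ : TangentBundle 𝓘(ℝ, ℝ) ℝ)) := by
    rw [← (tangentBundleModelSpaceHomeomorph 𝓘(ℝ, ℝ)).comp_continuous_iff]
    exact continuous_id.prodMk continuous_const
  have h3 : Continuous (fun t => (⟨γ t, velocity γ t⟩ : TangentBundle (𝓡 n) M)) := h1.comp h2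
  have h4 : Continuous fun t => g.inner (γ t) (velocity γ t) (velocity γ t) :=
    Continuous.inner_bundle (F := EuclideanSpace ℝ (Fin n)) (E := fun x : M => TangentSpace (𝓡 n) x)
       h3 h3
  exact h4.sqrt

end Length

/-! ### Comparison of norms, and linear test functions in a chart. -/

section Comparison

variable {n : ℕ} {M : Type*} [TopologicalSpace M] [ChartedSpace (EuclideanSpace ℝ (Fin n)) M]
  [IsManifold (𝓡 n) ∞ M]

theorem isContinuousRiemannianBundle (g : RiemMetric n M) :
    letI : Bundle.RiemannianBundle (fun x : M => TangentSpace (𝓡 n) x) := ⟨g.toRiemannianMetric⟩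
    IsContinuousRiemannianBundle (EuclideanSpace ℝ (Fin n)) (fun x : M => TangentSpace (𝓡 n) x) :=
  letI : Bundle.RiemannianBundle (fun x : M => TangentSpace (𝓡 n) x) := ⟨g.toRiemannianMetric⟩
  ⟨g.inner, g.contMDiff.continuous, fun _ _ _ => rfl⟩

theorem eventually_norm_trivialization_le (g : RiemMetric n M) (x : M) :
    ∃ C > 0, ∀ᶠ y in 𝓝 x, ∀ v : TangentSpace (𝓡 n) y,
      ‖(trivializationAt (EuclideanSpace ℝ (Fin n)) (TangentSpace (𝓡 n)) x).continuousLinearMapAt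
        ℝ y v‖ ≤ C * gnorm g y v := by
  let b₁ : Bundle.RiemannianBundle (fun x : M => TangentSpace (𝓡 n) x) := ⟨g.toRiemannianMetric⟩
  have := isContinuousRiemannianBundle g
  obtain ⟨C, hC, H⟩ := eventually_norm_trivializationAt_lt (EuclideanSpace ℝ (Fin n))
    (fun x : M => TangentSpace (𝓡 n) x) x
  refine ⟨C, hC, H.mono fun y hy v => ?_⟩
  refine (ContinuousLinearMap.le_of_opNorm_le _ hy.le v).trans_eq ?_
  exact congrArg (C * ·) (norm_eq_sqrt_real_inner v)

theorem eventually_gnorm_symmL_le (g : RiemMetric n M) (x : M) :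
    ∃ C > 0, ∀ᶠ y in 𝓝 x, ∀ v : EuclideanSpace ℝ (Fin n),
      gnorm g y ((trivializationAt (EuclideanSpace ℝ (Fin n)) (TangentSpace (𝓡 n)) x).symmL
        ℝ y v) ≤ C * ‖v‖ := by
  let b₁ : Bundle.RiemannianBundle (fun x : M => TangentSpace (𝓡 n) x) := ⟨g.toRiemannianMetric⟩
  have := isContinuousRiemannianBundle g
  obtain ⟨C, hC, H⟩ := eventually_norm_symmL_trivializationAt_lt (EuclideanSpace ℝ (Fin n))
    (fun x : M => TangentSpace (𝓡 n) x) x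
  refine ⟨C, hC, H.mono fun y hy v => ?_⟩
  refine Eq.trans_le ?_ (ContinuousLinearMap.le_of_opNorm_le _ hy.le v)
  exact (norm_eq_sqrt_real_inner (F := TangentSpace (𝓡 n) y) _).symm

/-- Both norms are locally comparable with the Euclidean norm of the model fibre; compactness turns
the local constants into one. -/
theorem exists_gnorm_le_mul [CompactSpace M] (g h : RiemMetric n M) :
    ∃ C > 0, ∀ x v, gnorm h x v ≤ C * gnorm g x v := by
  suffices H : ∃ C > 0, ∀ x ∈ (univ : Set M), ∀ v, gnorm h x v ≤ C * gnorm g x v by simpa using H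
  refine isCompact_univ.induction_on (p := fun s : Set M =>
    ∃ C > 0, ∀ x ∈ s, ∀ v, gnorm h x v ≤ C * gnorm g x v) ⟨1, one_pos, by simp⟩ ?_ ?_ ?_
  · rintro s t hst ⟨C, hC, H⟩
    exact ⟨C, hC, fun x hx => H x (hst hx)⟩
  · rintro s t ⟨C, hC, H⟩ ⟨D, hD, H'⟩
    refine ⟨max C D, lt_max_of_lt_left hC, ?_⟩
    rintro x (hx | hx) v
    · exact (H x hx v).trans (mul_le_mul_of_nonneg_right (le_max_left _ _) (gnorm_nonneg _ _ _))
    · exact (H' x hx v).trans (mul_le_mul_of_nonneg_right (le_max_right _ _) (gnorm_nonneg _ _ _))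
  · intro x _
    obtain ⟨C, hC, H⟩ := eventually_norm_trivialization_le g x
    obtain ⟨D, hD, H'⟩ := eventually_gnorm_symmL_le h x
    let e := trivializationAt (EuclideanSpace ℝ (Fin n)) (TangentSpace (𝓡 n)) x
    have hb := e.open_baseSet.mem_nhds (FiberBundle.mem_baseSet_trivializationAt' x)
    refine ⟨_, mem_nhdsWithin_of_mem_nhds (inter_mem (inter_mem H H') hb), D * C, by positivity, ?_⟩
    rintro y ⟨⟨hy, hy'⟩, hyb⟩ v
    have := hy' (e.continuousLinearMapAt ℝ y v)
    rw [Bundle.Trivialization.symmL_continuousLinearMapAt _ hyb] at this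
    refine this.trans ?_
    rw [mul_assoc]
    exact mul_le_mul_of_nonneg_left (hy v) hD.le

/-- Near `x`, the `g`-gradient of the linear function `g(v, ·)`, read in the chart at `x`,
is almost bounded by the norm of `v`. -/
theorem exists_linear_test_function (g : RiemMetric n M) (x : M) (v : TangentSpace (𝓡 n) x)
    {r : ℝ} (hr : 1 < r) :
    ∃ ℓ : EuclideanSpace ℝ (Fin n) →L[ℝ] ℝ,
      (∀ ξ : TangentSpace (𝓡 n) x,
        ℓ (mfderiv (𝓡 n) 𝓘(ℝ, EuclideanSpace ℝ (Fin n)) (extChartAt (𝓡 n) x) x ξ) =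
          g.inner x v ξ) ∧
      ∀ᶠ y in 𝓝 x, ∀ ξ : TangentSpace (𝓡 n) y,
        |ℓ (mfderiv (𝓡 n) 𝓘(ℝ, EuclideanSpace ℝ (Fin n)) (extChartAt (𝓡 n) x) y ξ)| ≤
          r * gnorm g x v * gnorm g y ξ := by
  let b₁ : Bundle.RiemannianBundle (fun x : M => TangentSpace (𝓡 n) x) := ⟨g.toRiemannianMetric⟩
  have := isContinuousRiemannianBundle g
  let e := trivializationAt (EuclideanSpace ℝ (Fin n)) (TangentSpace (𝓡 n)) x
  have key : ∀ y ∈ (chartAt (EuclideanSpace ℝ (Fin n)) x).source, ∀ ξ : TangentSpace (𝓡 n) y,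
      mfderiv (𝓡 n) 𝓘(ℝ, EuclideanSpace ℝ (Fin n)) (extChartAt (𝓡 n) x) y ξ =
        e.continuousLinearMapAt ℝ y ξ := fun y hy ξ => by
    rw [TangentBundle.continuousLinearMapAt_trivializationAt hy]
    rfl
  -- The covector `g(v, ·)` at `x` is extended as a constant in the trivialization. Cauchy–Schwarz
  -- at `x` bounds it, and `r` absorbs the distortion of the norm when a vector is carried from `y`
  -- to `x`.
  refine ⟨(g.inner x v).comp (e.symmL ℝ x), fun ξ => ?_, ?_⟩
  · rw [key x (mem_chart_source _ x)]
    exact congrArg (g.inner x v)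
      (e.symmL_continuousLinearMapAt (FiberBundle.mem_baseSet_trivializationAt' x) ξ)
  · filter_upwards [eventually_norm_symmL_trivializationAt_self_comp_lt (EuclideanSpace ℝ (Fin n))
      (fun x : M => TangentSpace (𝓡 n) x) x hr,
      chart_source_mem_nhds (EuclideanSpace ℝ (Fin n)) x] with y hy hys ξ
    rw [key y hys]
    have h1 : |g.inner x v (e.symmL ℝ x (e.continuousLinearMapAt ℝ y ξ))| ≤
        gnorm g x v * gnorm g x (e.symmL ℝ x (e.continuousLinearMapAt ℝ y ξ)) := by
      have := abs_real_inner_le_norm v (e.symmL ℝ x (e.continuousLinearMapAt ℝ y ξ))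
      rw [norm_eq_sqrt_real_inner, norm_eq_sqrt_real_inner] at this
      exact this
    have h2 : gnorm g x (e.symmL ℝ x (e.continuousLinearMapAt ℝ y ξ)) ≤ r * gnorm g y ξ := by
      have := ContinuousLinearMap.le_of_opNorm_le _ hy.le ξ
      rw [norm_eq_sqrt_real_inner, norm_eq_sqrt_real_inner] at this
      exact this
    refine h1.trans ((mul_le_mul_of_nonneg_left h2 (gnorm_nonneg _ _ _)).trans_eq ?_)
    ring

end Comparison

/-! ### Local Lipschitz bound from a gradient bound. -/

section Local

variable {n : ℕ} {M : Type*} [TopologicalSpace M] [ChartedSpace (EuclideanSpace ℝ (Fin n)) M]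
  [IsManifold (𝓡 n) ∞ M]

theorem hasDerivAt_linear_comp_extChartAt {γ : ℝ → M} (hγ : ContMDiff 𝓘(ℝ, ℝ) (𝓡 n) 1 γ) (x : M)
    (ℓ : EuclideanSpace ℝ (Fin n) →L[ℝ] ℝ) {t : ℝ}
    (ht : γ t ∈ (chartAt (EuclideanSpace ℝ (Fin n)) x).source) :
    HasDerivAt (fun t => ℓ (extChartAt (𝓡 n) x (γ t)))
      (ℓ (mfderiv (𝓡 n) 𝓘(ℝ, EuclideanSpace ℝ (Fin n)) (extChartAt (𝓡 n) x) (γ t)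
        (velocity γ t))) t := by
  have h1 := ((mdifferentiableAt_extChartAt (I := 𝓡 n) ht).hasMFDerivAt.comp t
    (hγ.mdifferentiable one_ne_zero t).hasMFDerivAt).hasFDerivAt
  exact (ℓ.hasFDerivAt.comp t h1).hasDerivAt

/-- Integrate the derivative along an almost minimal path. The bound on the derivative is only
local, so the path must be kept close to `x`. -/
theorem eventually_ofReal_abs_sub_le [T3Space M] (g : RiemMetric n M) {x : M} {c : ℝ}
    (ℓ : EuclideanSpace ℝ (Fin n) →L[ℝ] ℝ) (hc : 0 < c)
    (hle : ∀ᶠ y in 𝓝 x, ∀ ξ : TangentSpace (𝓡 n) y,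
        |ℓ (mfderiv (𝓡 n) 𝓘(ℝ, EuclideanSpace ℝ (Fin n)) (extChartAt (𝓡 n) x) y ξ)| ≤
          c * gnorm g y ξ) :
    ∀ᶠ p : M × M in 𝓝 x ×ˢ 𝓝 x,
      ENNReal.ofReal |ℓ (extChartAt (𝓡 n) x p.2) - ℓ (extChartAt (𝓡 n) x p.1)| ≤
        ENNReal.ofReal c * riemEDist g p.1 p.2 := by
  obtain ⟨δ, hδ, hball⟩ : ∃ δ > 0, ∀ y, riemEDist g x y < δ →
      y ∈ (chartAt (EuclideanSpace ℝ (Fin n)) x).source ∧ ∀ ξ : TangentSpace (𝓡 n) y,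
        |ℓ (mfderiv (𝓡 n) 𝓘(ℝ, EuclideanSpace ℝ (Fin n)) (extChartAt (𝓡 n) x) y ξ)| ≤
          c * gnorm g y ξ := by
    let b₁ : Bundle.RiemannianBundle (fun x : M => TangentSpace (𝓡 n) x) := ⟨g.toRiemannianMetric⟩
    have := isContinuousRiemannianBundle g
    obtain ⟨δ, hδ, H⟩ := setOfPred_riemannianEDist_lt_subset_nhds (𝓡 n)
      (inter_mem (chart_source_mem_nhds (EuclideanSpace ℝ (Fin n)) x) hle)
    exact ⟨δ, by simpa using hδ, fun y hy => H hy⟩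
  -- With endpoints within `δ / 4` of `x` and length below `δ / 2`, the path stays within `3δ / 4`
  -- of `x`.
  have hnear : ∀ᶠ y in 𝓝 x, riemEDist g x y < δ / 2 / 2 := by
    let b₁ : Bundle.RiemannianBundle (fun x : M => TangentSpace (𝓡 n) x) := ⟨g.toRiemannianMetric⟩
    have := isContinuousRiemannianBundle g
    exact eventually_riemannianEDist_lt (𝓡 n) x (ENNReal.half_pos (ENNReal.half_pos hδ.ne').ne')
  filter_upwards [hnear.prod_mk hnear] with p hp
  obtain ⟨y, z⟩ := p
  obtain ⟨hy, hz⟩ : riemEDist g x y < δ / 2 / 2 ∧ riemEDist g x z < δ / 2 / 2 := hp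
  have hyz : riemEDist g y z < δ / 2 / 2 + δ / 2 / 2 :=
    (riemEDist_triangle g y x z).trans_lt (ENNReal.add_lt_add (riemEDist_comm g x y ▸ hy) hz)
  have hC0 : ENNReal.ofReal c ≠ 0 := by simpa using hc
  rw [mul_comm, ← ENNReal.div_le_iff_le_mul (.inl hC0) (.inl ENNReal.ofReal_ne_top)]
  refine le_of_forall_gt fun r hr => ?_
  obtain ⟨γ, rfl, rfl, hγ, hl⟩ := exists_length_lt g (lt_min hr hyz)
  refine lt_of_le_of_lt ?_ (hl.trans_le (min_le_left _ _))
  rw [ENNReal.div_le_iff_le_mul (.inl hC0) (.inl ENNReal.ofReal_ne_top), mul_comm]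
  have hin : ∀ t ∈ Icc (0 : ℝ) 1, riemEDist g x (γ t) < δ := fun t ht => by
    have h1 : riemEDist g (γ 0) (γ t) < δ / 2 / 2 + δ / 2 / 2 :=
      ((riemEDist_le_length g hγ ht.1).trans (length_mono g γ le_rfl ht.2)).trans_lt
        (hl.trans_le (min_le_right _ _))
    refine ((riemEDist_triangle g x (γ 0) (γ t)).trans_lt (ENNReal.add_lt_add hy h1)).trans_le ?_
    calc δ / 2 / 2 + (δ / 2 / 2 + δ / 2 / 2) = δ / 2 / 2 + δ / 2 := by rw [ENNReal.add_halves]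
      _ ≤ δ / 2 + δ / 2 := by gcongr; exact ENNReal.half_le_self
      _ = δ := ENNReal.add_halves δ
  have hd := fun t ht => hasDerivAt_linear_comp_extChartAt hγ x ℓ (hball _ (hin t ht)).1
  have hcont : ContDiffOn ℝ 1 (fun t => ℓ (extChartAt (𝓡 n) x (γ t))) (Icc 0 1) := by
    refine ℓ.contDiff.comp_contDiffOn (contMDiffOn_iff_contDiffOn.1 ?_)
    exact (contMDiffOn_extChartAt (I := 𝓡 n) (n := 1)).comp hγ.contMDiffOn
      fun t ht => (hball _ (hin t ht)).1
  rw [← Real.norm_eq_abs, ofReal_norm]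
  refine (enorm_sub_le_lintegral_deriv_of_contDiffOn_Icc hcont zero_le_one).trans ?_
  rw [length, ← lintegral_const_mul' _ _ ENNReal.ofReal_ne_top]
  refine setLIntegral_mono' measurableSet_Icc fun t ht => ?_
  rw [(hd t ht).deriv, ← ENNReal.ofReal_mul hc.le, ← ofReal_norm, Real.norm_eq_abs]
  exact ENNReal.ofReal_le_ofReal ((hball _ (hin t ht)).2 _)

end Local

/-! ### Ratio of two distances on short pieces of a path. -/

section Ratio

variable {n : ℕ} {M : Type*} [TopologicalSpace M] [ChartedSpace (EuclideanSpace ℝ (Fin n)) M]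
  [IsManifold (𝓡 n) ∞ M]

theorem length_le_ofReal (g : RiemMetric n M) {γ : ℝ → M} {a b A : ℝ} (hA : 0 ≤ A)
    (H : ∀ t ∈ Icc a b, speed g γ t ≤ A) : length g γ a b ≤ ENNReal.ofReal (A * (b - a)) := by
  refine (setLIntegral_mono' (g := fun _ => ENNReal.ofReal A) measurableSet_Icc fun t ht =>
    ENNReal.ofReal_le_ofReal (H t ht)).trans_eq ?_
  rw [setLIntegral_const, Real.volume_Icc, ENNReal.ofReal_mul hA]

/-- A `C^1` path expands the `g`-distance at least by almost its `g`-speed. -/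
theorem eventually_mul_sub_le_riemEDist [T3Space M] (g : RiemMetric n M) {γ : ℝ → M}
    (hγ : ContMDiff 𝓘(ℝ, ℝ) (𝓡 n) 1 γ) {s r : ℝ} (hs : 0 < speed g γ s) (hr : 1 < r) :
    ∃ δ > 0, ∀ t ∈ Ioo (s - δ) (s + δ), ∀ t' ∈ Ioo (s - δ) (s + δ), t ≤ t' →
      ENNReal.ofReal (speed g γ s / r ^ 2 * (t' - t)) ≤ riemEDist g (γ t) (γ t') := by
  have hr0 : 0 < r := one_pos.trans hr
  set b := speed g γ s with hb
  -- A calibration argument: near `γ s`, `ℓ` in the chart is `r b`-Lipschitz for `d_g`, while along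
  -- `γ` its derivative is `b ^ 2` at `s`, hence above `b ^ 2 / r` nearby. Dividing gives the rate
  -- `b / r ^ 2`.
  obtain ⟨ℓ, hℓ, hev⟩ := exists_linear_test_function g (γ s) (velocity γ s) hr
  have hpair := eventually_ofReal_abs_sub_le g ℓ (mul_pos hr0 hs) hev
  have hpair' : ∀ᶠ p : ℝ × ℝ in 𝓝 s ×ˢ 𝓝 s, _ :=
    ((hγ.continuous.tendsto s).prodMap (hγ.continuous.tendsto s)).eventually hpair
  obtain ⟨V, hV, hVp⟩ := mem_prod_self_iff.1 hpair'
  let F : ℝ → ℝ := fun t => ℓ (extChartAt (𝓡 n) (γ s) (γ t))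
  let U : Set ℝ := γ ⁻¹' (chartAt (EuclideanSpace ℝ (Fin n)) (γ s)).source
  have hU : IsOpen U := (chartAt (EuclideanSpace ℝ (Fin n)) (γ s)).open_source.preimage hγ.continuous
  have hsU : s ∈ U := mem_chart_source _ (γ s)
  have hF : ∀ t ∈ U, HasDerivAt F _ t := fun t ht =>
    hasDerivAt_linear_comp_extChartAt hγ (γ s) ℓ ht
  have hFs : deriv F s = b ^ 2 := by
    rw [(hF s hsU).deriv, hℓ, hb, speed, gnorm_sq]
  have hFc : ContDiffOn ℝ 1 F U := by
    refine ℓ.contDiff.comp_contDiffOn (contMDiffOn_iff_contDiffOn.1 ?_)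
    exact (contMDiffOn_extChartAt (I := 𝓡 n) (n := 1)).comp hγ.contMDiffOn fun t ht => ht
  have hder : ∀ᶠ t in 𝓝 s, b ^ 2 / r < deriv F t := by
    have h1 := (hFc.continuousOn_deriv_of_isOpen hU le_rfl).continuousAt (hU.mem_nhds hsU)
    refine h1.eventually_const_lt ?_
    rw [hFs]
    exact div_lt_self (by positivity) hr
  obtain ⟨δ, hδ, hball⟩ := Metric.mem_nhds_iff.1 (inter_mem (inter_mem hV (hU.mem_nhds hsU)) hder)
  rw [Real.ball_eq_Ioo] at hball
  refine ⟨δ, hδ, fun t ht t' ht' htt' => ?_⟩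
  have h1 := (convex_Ioo (s - δ) (s + δ)).mul_sub_le_image_sub_of_le_deriv
    (fun t ht => (hF t (hball ht).1.2).continuousAt.continuousWithinAt)
    (fun t ht => (hF t (hball (interior_subset ht)).1.2).differentiableAt.differentiableWithinAt)
    (fun t ht => (hball (interior_subset ht)).2.le) t ht t' ht' htt'
  have h2 : ENNReal.ofReal |F t' - F t| ≤ ENNReal.ofReal (r * b) * riemEDist g (γ t) (γ t') :=
    hVp (mk_mem_prod (hball ht).1.1 (hball ht').1.1)
  have h3 : ENNReal.ofReal (r * b) * ENNReal.ofReal (b / r ^ 2 * (t' - t)) ≤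
      ENNReal.ofReal (r * b) * riemEDist g (γ t) (γ t') := by
    refine le_trans ?_ h2
    rw [← ENNReal.ofReal_mul (by positivity)]
    refine ENNReal.ofReal_le_ofReal (le_trans (le_of_eq ?_) (h1.trans (le_abs_self _)))
    field_simp
  exact (ENNReal.mul_le_mul_iff_right (by simpa using mul_pos hr0 hs) ENNReal.ofReal_ne_top).1 h3

/-- On a short piece of a `C^1` path, the ratio of two Riemannian distances is almost the ratio
of the speeds of the path. -/
theorem exists_local_ratio [T3Space M] {g h : RiemMetric n M} {C : ℝ} (hC : 0 < C)
    (H : ∀ x v, gnorm h x v ≤ C * gnorm g x v) {γ : ℝ → M} (hγ : ContMDiff 𝓘(ℝ, ℝ) (𝓡 n) 1 γ)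
    (s : ℝ) {ε : ℝ} (hε : 0 < ε) :
    ∃ ρ > 0, ∃ δ > 0, (∀ t ∈ Ioo (s - δ) (s + δ), ρ * speed g γ t ≤ speed h γ t + ε) ∧
      ∀ t ∈ Ioo (s - δ) (s + δ), ∀ t' ∈ Ioo (s - δ) (s + δ),
        riemEDist h (γ t) (γ t') ≤ ENNReal.ofReal ρ * riemEDist g (γ t) (γ t') := by
  have cg := (continuous_speed g hγ).continuousAt (x := s)
  have ch := (continuous_speed h hγ).continuousAt (x := s)
  rcases (speed_nonneg g γ s).eq_or_lt with hs | hs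
  -- At zero `g`-speed there is no ratio of speeds, but the global constant `C` costs less than `ε`
  -- nearby.
  · have : ∀ᶠ t in 𝓝 s, C * speed g γ t < ε :=
      (cg.const_mul C).eventually_lt_const (by simpa [← hs] using hε)
    obtain ⟨δ, hδ, hball⟩ := Metric.mem_nhds_iff.1 this
    rw [Real.ball_eq_Ioo] at hball
    exact ⟨C, hC, δ, hδ, fun t ht => by
      have := mem_ofPred.1 (hball ht)
      linarith [speed_nonneg h γ t],
      fun t _ t' _ => riemEDist_le_mul hC H _ _⟩
  set a := speed h γ s with ha
  set b := speed g γ s with hb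
  have ha0 : 0 ≤ a := speed_nonneg h γ s
  -- The ratio will be `ρ = (a + ε / 4) r ^ 2 / b`: the numerator `a + ε / 4` bounds the `h`-speed
  -- and `b / r ^ 2` is the growth rate of `d_g`. As the `g`-speed is below `b r`, the product with
  -- `ρ` is at most `(a + ε / 4) r ^ 3`, whence the choice of `r`.
  obtain ⟨r, hr1, hr⟩ : ∃ r : ℝ, 1 < r ∧ (a + ε / 4) * r ^ 3 < a + ε / 2 := by
    have hc : ContinuousAt (fun r : ℝ => (a + ε / 4) * r ^ 3) 1 := by fun_prop
    have h1 : ∀ᶠ r in 𝓝[>] (1 : ℝ), (a + ε / 4) * r ^ 3 < a + ε / 2 :=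
      (hc.eventually_lt_const (by linarith)).filter_mono nhdsWithin_le_nhds
    obtain ⟨r, hr, hr'⟩ := (h1.and self_mem_nhdsWithin).exists
    exact ⟨r, hr', hr⟩
  have hr0 : 0 < r := one_pos.trans hr1
  obtain ⟨δ₁, hδ₁, hlow⟩ := eventually_mul_sub_le_riemEDist g hγ hs hr1
  rw [← hb] at hlow
  obtain ⟨δ₂, hδ₂, hball⟩ := Metric.mem_nhds_iff.1
    (((cg.eventually_lt_const (show b < b * r from lt_mul_of_one_lt_right hs hr1)).and
      ((ch.eventually_lt_const (show a < a + ε / 4 by linarith)).and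
        (ch.eventually_const_lt (show a - ε / 2 < a by linarith)))))
  rw [Real.ball_eq_Ioo] at hball
  have hsub₁ : Ioo (s - min δ₁ δ₂) (s + min δ₁ δ₂) ⊆ Ioo (s - δ₁) (s + δ₁) :=
    Ioo_subset_Ioo (by linarith [min_le_left δ₁ δ₂]) (by linarith [min_le_left δ₁ δ₂])
  have hsub₂ : Ioo (s - min δ₁ δ₂) (s + min δ₁ δ₂) ⊆ Ioo (s - δ₂) (s + δ₂) :=
    Ioo_subset_Ioo (by linarith [min_le_right δ₁ δ₂]) (by linarith [min_le_right δ₁ δ₂])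
  have hρ : 0 < (a + ε / 4) * r ^ 2 / b := by positivity
  refine ⟨(a + ε / 4) * r ^ 2 / b, hρ, min δ₁ δ₂, lt_min hδ₁ hδ₂,
    fun t ht => ?_, ?_⟩
  · obtain ⟨h1, -, h3⟩ := hball (hsub₂ ht)
    have h4 := mul_le_mul_of_nonneg_left h1.le hρ.le
    have h5 : (a + ε / 4) * r ^ 2 / b * (b * r) = (a + ε / 4) * r ^ 3 := by field_simp
    linarith
  have key : ∀ t ∈ Ioo (s - min δ₁ δ₂) (s + min δ₁ δ₂),
      ∀ t' ∈ Ioo (s - min δ₁ δ₂) (s + min δ₁ δ₂), t ≤ t' →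
        riemEDist h (γ t) (γ t') ≤
          ENNReal.ofReal ((a + ε / 4) * r ^ 2 / b) * riemEDist g (γ t) (γ t') := by
    intro t ht t' ht' htt'
    refine (riemEDist_le_length h hγ htt').trans ((length_le_ofReal h (by positivity)
      fun u hu => (hball (hsub₂ (ordConnected_Ioo.out ht ht' hu))).2.1.le).trans ?_)
    refine le_trans (le_of_eq ?_) (mul_le_mul_right (hlow t (hsub₁ ht) t' (hsub₁ ht') htt') _)
    rw [← ENNReal.ofReal_mul hρ.le]
    congr 1
    field_simp
  intro t ht t' ht'
  rcases le_total t t' with htt' | htt'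
  · exact key t ht t' ht' htt'
  · rw [riemEDist_comm h, riemEDist_comm g]
    exact key t' ht' t ht htt'

/-- The closed set `K` and the ratio `ρ > 0` are such that the `h`-distance is at most `ρ` times the
`g`-distance on `K`. -/
def IsRatio (g h : RiemMetric n M) (K : Set M) (ρ : ℝ) : Prop :=
  IsClosed K ∧ 0 < ρ ∧ ∀ y ∈ K, ∀ z ∈ K, riemEDist h y z ≤ ENNReal.ofReal ρ * riemEDist g y z

/-- Compactness of `[0, 1]` reduces to `exists_local_ratio`; the sets are images of closed
subintervals, and the path may cross itself. -/
theorem exists_path_isRatio [T3Space M] {g h : RiemMetric n M} {C : ℝ}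
    (hC : 0 < C) (H : ∀ x v, gnorm h x v ≤ C * gnorm g x v) {γ : ℝ → M}
    (hγ : ContMDiff 𝓘(ℝ, ℝ) (𝓡 n) 1 γ) {ε : ℝ} (hε : 0 < ε) :
    ∃ S : Set (Set M × ℝ), S.Finite ∧ (∀ p ∈ S, IsRatio g h p.1 p.2) ∧
      ∀ t ∈ Icc (0 : ℝ) 1, ∃ p ∈ S, γ t ∈ p.1 ∧ p.2 * speed g γ t ≤ speed h γ t + ε := by
  refine isCompact_Icc.induction_on (p := fun I : Set ℝ => ∃ S : Set (Set M × ℝ), S.Finite ∧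
    (∀ p ∈ S, IsRatio g h p.1 p.2) ∧
      ∀ t ∈ I, ∃ p ∈ S, γ t ∈ p.1 ∧ p.2 * speed g γ t ≤ speed h γ t + ε)
    ⟨∅, finite_empty, by simp, by simp⟩ ?_ ?_ ?_
  · rintro I J hIJ ⟨S, hS, h1, h2⟩
    exact ⟨S, hS, h1, fun t ht => h2 t (hIJ ht)⟩
  · rintro I J ⟨S, hS, h1, h2⟩ ⟨T, hT, h3, h4⟩
    refine ⟨S ∪ T, hS.union hT, fun p hp => hp.elim (h1 p) (h3 p), fun t ht => ?_⟩
    rcases ht with ht | ht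
    · obtain ⟨p, hp, hp'⟩ := h2 t ht
      exact ⟨p, .inl hp, hp'⟩
    · obtain ⟨p, hp, hp'⟩ := h4 t ht
      exact ⟨p, .inr hp, hp'⟩
  · intro s _
    obtain ⟨ρ, hρ, δ, hδ, h1, h2⟩ := exists_local_ratio hC H hγ s hε
    have hsub : Icc (s - δ / 2) (s + δ / 2) ⊆ Ioo (s - δ) (s + δ) :=
      Icc_subset_Ioo (by linarith) (by linarith)
    refine ⟨Icc (s - δ / 2) (s + δ / 2), mem_nhdsWithin_of_mem_nhds
      (Icc_mem_nhds (by linarith) (by linarith)), {(γ '' Icc (s - δ / 2) (s + δ / 2), ρ)},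
      finite_singleton _, ?_, fun t ht => ⟨_, rfl, mem_image_of_mem γ ht, h1 t (hsub ht)⟩⟩
    rintro p rfl
    refine ⟨(isCompact_Icc.image hγ.continuous).isClosed, hρ, ?_⟩
    rintro _ ⟨t, ht, rfl⟩ _ ⟨t', ht', rfl⟩
    exact h2 t (hsub ht) t' (hsub ht')

end Ratio

/-! ### Conformal rescaling and the lower bound on lengths. -/

section Conformal

variable {n : ℕ} {M : Type*} [TopologicalSpace M] [ChartedSpace (EuclideanSpace ℝ (Fin n)) M]
  [IsManifold (𝓡 n) ∞ M]

/-- The metric `w ^ 2 g`. -/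
def sqScale (g : RiemMetric n M) (w : M → ℝ) (hw : ContMDiff (𝓡 n) 𝓘(ℝ, ℝ) ∞ w)
    (hpos : ∀ x, 0 < w x) : RiemMetric n M where
  inner x := (w x ^ 2) • g.inner x
  symm x u v := by
    change w x ^ 2 * g.inner x u v = w x ^ 2 * g.inner x v u
    rw [g.symm]
  pos x v hv := mul_pos (pow_pos (hpos x) 2) (g.pos x v hv)
  isVonNBounded x := by
    have h : {v : TangentSpace (𝓡 n) x | ((w x ^ 2) • g.inner x) v v < 1} ⊆
        ((w x)⁻¹ • ContinuousLinearMap.id ℝ (TangentSpace (𝓡 n) x)) ''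
          {v : TangentSpace (𝓡 n) x | g.inner x v v < 1} := by
      intro v hv
      refine ⟨w x • v, ?_, inv_smul_smul₀ (hpos x).ne' v⟩
      have hv' : w x ^ 2 * g.inner x v v < 1 := hv
      have : g.inner x (w x • v) (w x • v) = w x ^ 2 * g.inner x v v := by
        simp only [map_smul, _root_.smul_apply, smul_eq_mul]
        ring
      exact this.trans_lt hv'
    exact ((g.isVonNBounded x).image
      ((w x)⁻¹ • ContinuousLinearMap.id ℝ (TangentSpace (𝓡 n) x))).subset h
  contMDiff := by
    have (x : M) : ContinuousAdd (TangentSpace (𝓡 n) x →L[ℝ] ℝ) :=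
      inferInstanceAs (ContinuousAdd (EuclideanSpace ℝ (Fin n) →L[ℝ] ℝ))
    exact (hw.pow 2).smul_section g.contMDiff

theorem isConformal_sqScale (g : RiemMetric n M) {w : M → ℝ}
    (hw : ContMDiff (𝓡 n) 𝓘(ℝ, ℝ) ∞ w) (hpos : ∀ x, 0 < w x) :
    IsConformal g (sqScale g w hw hpos) :=
  ⟨fun x => w x ^ 2, hw.pow 2, fun x => pow_pos (hpos x) 2, fun _ _ _ => rfl⟩

theorem gnorm_sqScale (g : RiemMetric n M) {w : M → ℝ} (hw : ContMDiff (𝓡 n) 𝓘(ℝ, ℝ) ∞ w)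
    (hpos : ∀ x, 0 < w x) (x : M) (v : TangentSpace (𝓡 n) x) :
    gnorm (sqScale g w hw hpos) x v = w x * gnorm g x v := by
  have : (sqScale g w hw hpos).inner x v v = w x ^ 2 * g.inner x v v := rfl
  rw [gnorm, this, Real.sqrt_mul (sq_nonneg _), Real.sqrt_sq (hpos x).le, gnorm]

/-- A path which spends its time in the sets `A i`, where the metric `g'` is at least `ρ i ^ 2 g`,
has `g'`-length bounded below by the `h`-distance, up to a controlled error. -/
theorem riemEDist_le_length_add {ι : Type*} {g g' h : RiemMetric n M} {A : ι → Set M} {ρ : ι → ℝ}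
    (S : Finset ι) {τ : ℝ≥0∞} (hA : ∀ i ∈ S, IsClosed (A i)) (hρ : ∀ i ∈ S, 0 ≤ ρ i)
    (hle : ∀ i ∈ S, ∀ y ∈ A i, ∀ z ∈ A i,
      riemEDist h y z ≤ ENNReal.ofReal (ρ i) * riemEDist g y z + τ)
    {γ : ℝ → M} (hγ : ContMDiff 𝓘(ℝ, ℝ) (𝓡 n) 1 γ) {a b : ℝ} (hab : a ≤ b)
    (hcov : ∀ t ∈ Ioo a b, ∃ i ∈ S, γ t ∈ A i ∧ ρ i * speed g γ t ≤ speed g' γ t) :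
    riemEDist h (γ a) (γ b) ≤ length g' γ a b + 3 ^ S.card * τ := by
  classical
  induction hS : S.card generalizing S a b with
  | zero =>
    obtain rfl := Finset.card_eq_zero.1 hS
    obtain rfl : a = b := by
      by_contra hne
      obtain ⟨t, ht⟩ := nonempty_Ioo.2 (lt_of_le_of_ne hab hne)
      simpa using hcov t ht
    simp [riemEDist_self]
  | succ k ih =>
    have hne : S.Nonempty := Finset.card_pos.1 (by omega)
    -- For the smallest `ρ i`, the bound `ρ i * speed g ≤ speed g'` holds at all times in the open
    -- interval, whichever set covers them.
    obtain ⟨i, hi, hmin⟩ := S.exists_min_image ρ hne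
    have hcard : (S.erase i).card = k := by rw [Finset.card_erase_of_mem hi, hS]; rfl
    have ih' : ∀ {c d : ℝ}, a ≤ c → c ≤ d → d ≤ b → (∀ t ∈ Ioo c d, γ t ∉ A i) →
        riemEDist h (γ c) (γ d) ≤ length g' γ c d + 3 ^ k * τ := by
      intro c d hac hcd hdb hnot
      refine ih (S.erase i) (fun j hj => hA j (Finset.mem_of_mem_erase hj))
        (fun j hj => hρ j (Finset.mem_of_mem_erase hj))
        (fun j hj => hle j (Finset.mem_of_mem_erase hj)) hcd (fun t ht => ?_) hcard
      obtain ⟨j, hj, hj', hj''⟩ := hcov t (Ioo_subset_Ioo hac hdb ht)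
      refine ⟨j, Finset.mem_erase.2 ⟨?_, hj⟩, hj', hj''⟩
      rintro rfl
      exact hnot t ht hj'
    have hmono : (3 : ℝ≥0∞) ^ k * τ ≤ 3 ^ (k + 1) * τ :=
      mul_le_mul_left (pow_le_pow_right₀ (by norm_num) k.le_succ) _
    rcases (Icc a b ∩ γ ⁻¹' A i).eq_empty_or_nonempty with hT | hT
    · refine (ih' le_rfl hab le_rfl fun t ht hti => ?_).trans (add_le_add_right hmono _)
      exact (hT ▸ ⟨Ioo_subset_Icc_self ht, hti⟩ : t ∈ (∅ : Set ℝ))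
    have hcomp : IsCompact (Icc a b ∩ γ ⁻¹' A i) :=
      isCompact_Icc.inter_right ((hA i hi).preimage hγ.continuous)
    -- Between the first and last visits to `A i`, the estimate on `A i` applies to the two
    -- endpoints at once, so intermediate exits cost nothing. The outer pieces avoid `A i` except at
    -- `c` and `d`, which is why the covering is required on open intervals only.
    obtain ⟨c, ⟨hc, hcA⟩, hcmin⟩ := hcomp.exists_isLeast hT
    obtain ⟨d, ⟨hd, hdA⟩, hdmax⟩ := hcomp.exists_isGreatest hT
    have hcd : c ≤ d := hcmin ⟨hd, hdA⟩
    have h1 := ih' le_rfl hc.1 hc.2 fun t ht hti =>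
      (hcmin ⟨⟨ht.1.le, ht.2.le.trans hc.2⟩, hti⟩).not_gt ht.2
    have h3 := ih' hd.1 hd.2 le_rfl fun t ht hti =>
      (hdmax ⟨⟨hd.1.trans ht.1.le, ht.2.le⟩, hti⟩).not_gt ht.1
    have h2 : riemEDist h (γ c) (γ d) ≤ length g' γ c d + τ := by
      refine (hle i hi _ hcA _ hdA).trans (add_le_add_left ?_ _)
      refine (mul_le_mul_right (riemEDist_le_length g hγ hcd) _).trans (mul_length_le (hρ i hi) ?_)
      intro t ht
      obtain ⟨j, hj, -, hj'⟩ := hcov t (Ioo_subset_Ioo hc.1 hd.2 ht)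
      exact (mul_le_mul_of_nonneg_right (hmin j hj) (speed_nonneg _ _ _)).trans hj'
    -- Two outer pieces and one middle piece: `2 * 3 ^ k + 1 ≤ 3 ^ (k + 1)`.
    have hτ : (3 : ℝ≥0∞) ^ k * τ + τ + 3 ^ k * τ ≤ 3 ^ (k + 1) * τ := by
      have : τ ≤ 3 ^ k * τ := le_mul_of_one_le_left' (one_le_pow₀ (by norm_num))
      calc (3 : ℝ≥0∞) ^ k * τ + τ + 3 ^ k * τ ≤ 3 ^ k * τ + 3 ^ k * τ + 3 ^ k * τ := by gcongr
        _ = 3 ^ (k + 1) * τ := by ring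
    calc riemEDist h (γ a) (γ b)
        ≤ riemEDist h (γ a) (γ c) + riemEDist h (γ c) (γ d) + riemEDist h (γ d) (γ b) :=
          (riemEDist_triangle h _ (γ d) _).trans
            (add_le_add_left (riemEDist_triangle h _ (γ c) _) _)
      _ ≤ (length g' γ a c + 3 ^ k * τ) + (length g' γ c d + τ) +
          (length g' γ d b + 3 ^ k * τ) := by gcongr
      _ = (length g' γ a c + length g' γ c d + length g' γ d b) +
          (3 ^ k * τ + τ + 3 ^ k * τ) := by ring
      _ = length g' γ a b + (3 ^ k * τ + τ + 3 ^ k * τ) := by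
          rw [length_add g' γ hc.1 hcd, length_add g' γ (hc.1.trans hcd) hd.2]
      _ ≤ length g' γ a b + 3 ^ (k + 1) * τ := by gcongr

end Conformal

/-! ### Thickening the pieces and building the smooth weight. -/

section Weight

variable {n : ℕ} {M : Type*} [TopologicalSpace M] [ChartedSpace (EuclideanSpace ℝ (Fin n)) M]
  [IsManifold (𝓡 n) ∞ M] [T2Space M] [CompactSpace M]

/-- Since distances are finite, adding `τ` makes the inequality strict, hence open around `K × K`;
the tube lemma and normality give the closed neighbourhood. -/
theorem IsRatio.exists_closed_nhds [ConnectedSpace M] {g h : RiemMetric n M} {K : Set M} {ρ : ℝ}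
    (hK : IsRatio g h K ρ) {τ : ℝ≥0∞} (hτ : τ ≠ 0) :
    ∃ A, IsClosed A ∧ K ⊆ interior A ∧
      ∀ y ∈ A, ∀ z ∈ A, riemEDist h y z ≤ ENNReal.ofReal ρ * riemEDist g y z + τ := by
  obtain ⟨hcl, hρ, hle⟩ := hK
  have hopen : IsOpen {p : M × M | riemEDist h p.1 p.2 <
      ENNReal.ofReal ρ * riemEDist g p.1 p.2 + τ} :=
    isOpen_lt (continuous_riemEDist h)
      (((ENNReal.continuous_const_mul ENNReal.ofReal_ne_top).comp (continuous_riemEDist g)).add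
        continuous_const)
  obtain ⟨U, V, hU, hV, hKU, hKV, hUV⟩ := generalized_tube_lemma hcl.isCompact hcl.isCompact hopen
    (fun p hp => (hle p.1 hp.1 p.2 hp.2).trans_lt (ENNReal.lt_add_right
      (ENNReal.mul_ne_top ENNReal.ofReal_ne_top (riemEDist_ne_top g _ _)) hτ))
  obtain ⟨W, hW, hKW, hWUV⟩ :=
    normal_exists_closure_subset hcl (hU.inter hV) (subset_inter hKU hKV)
  refine ⟨closure W, isClosed_closure, hKW.trans (hW.subset_interior_iff.2 subset_closure),
    fun y hy z hz => ?_⟩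
  exact (hUV (mk_mem_prod (hWUV hy).1 (hWUV hz).2) : (y, z) ∈ {p : M × M | riemEDist h p.1 p.2 <
      ENNReal.ofReal ρ * riemEDist g p.1 p.2 + τ}).le

/-- The admissible values at a point form an interval. Near `x` the constant `min {ρ i | x ∈ K i}`
is admissible: nearby points stay in the corresponding `A i` and meet no `K j` that misses `x`. A
partition of unity glues these constants. -/
theorem exists_smooth_weight {ι : Type*} (S : Finset ι) {K A : ι → Set M} {ρ : ι → ℝ}
    (hK : ∀ i ∈ S, IsClosed (K i)) (hKA : ∀ i ∈ S, K i ⊆ interior (A i))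
    (hcov : ∀ x, ∃ i ∈ S, x ∈ K i) :
    ∃ w : M → ℝ, ContMDiff (𝓡 n) 𝓘(ℝ, ℝ) ∞ w ∧ (∀ x, ∃ i ∈ S, x ∈ A i ∧ ρ i ≤ w x) ∧
      ∀ x, ∀ i ∈ S, x ∈ K i → w x ≤ ρ i := by
  classical
  let T : M → Set ℝ := fun x => {c | (∃ i ∈ S, x ∈ A i ∧ ρ i ≤ c) ∧ ∀ i ∈ S, x ∈ K i → c ≤ ρ i}
  have hconv : ∀ x, Convex ℝ (T x) := by
    intro x
    rw [convex_iff_ordConnected, ordConnected_iff]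
    rintro c ⟨⟨i, hi, hx, hc⟩, -⟩ d ⟨-, hd⟩ - e he
    exact ⟨⟨i, hi, hx, hc.trans he.1⟩, fun j hj hxj => he.2.trans (hd j hj hxj)⟩
  have hloc : ∀ x, ∃ c : ℝ, ∀ᶠ y in 𝓝 x, c ∈ T y := by
    intro x
    have hne : (S.filter fun i => x ∈ K i).Nonempty := by
      obtain ⟨i, hi, hx⟩ := hcov x
      exact ⟨i, Finset.mem_filter.2 ⟨hi, hx⟩⟩
    obtain ⟨i, hi, hmin⟩ := Finset.exists_min_image _ ρ hne
    obtain ⟨hi, hx⟩ := Finset.mem_filter.1 hi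
    refine ⟨ρ i, ?_⟩
    have h1 : ∀ᶠ y in 𝓝 x, y ∈ A i := mem_interior_iff_mem_nhds.1 (hKA i hi hx)
    have h2 : ∀ᶠ y in 𝓝 x, ∀ j ∈ S, x ∉ K j → y ∉ K j := by
      rw [Filter.eventually_all_finset]
      intro j hj
      by_cases hxj : x ∈ K j
      · simp [hxj]
      · filter_upwards [(hK j hj).isOpen_compl.mem_nhds hxj] with y hy _ using hy
    filter_upwards [h1, h2] with y hy1 hy2
    refine ⟨⟨i, hi, hy1, le_rfl⟩, fun j hj hyj => hmin j (Finset.mem_filter.2 ⟨hj, ?_⟩)⟩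
    by_contra hxj
    exact hy2 j hj hxj hyj
  obtain ⟨w, hw⟩ := exists_contMDiffMap_forall_mem_convex_of_local_const (n := (⊤ : ℕ∞)) (𝓡 n)
    hconv hloc
  exact ⟨w, w.contMDiff, fun x => (hw x).1, fun x => (hw x).2⟩

end Weight

/-! ### Finite nets. -/

section Net

variable {n : ℕ} {M : Type*} [TopologicalSpace M] [ChartedSpace (EuclideanSpace ℝ (Fin n)) M]
  [IsManifold (𝓡 n) ∞ M] [T2Space M] [CompactSpace M]

theorem exists_finite_net (g : RiemMetric n M) {δ : ℝ≥0∞} (hδ : 0 < δ) :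
    ∃ s : Set M, s.Finite ∧ ∀ x, ∃ y ∈ s, riemEDist g x y < δ := by
  obtain ⟨s, -, hs⟩ := isCompact_univ.elim_nhds_subcover (fun y => {x | riemEDist g x y < δ})
    (fun y _ => (isOpen_lt ((continuous_riemEDist g).comp (continuous_id.prodMk continuous_const))
      continuous_const).mem_nhds (by simpa [riemEDist_self] using hδ))
  refine ⟨s, s.finite_toSet, fun x => ?_⟩
  obtain ⟨y, hy, hxy⟩ := mem_iUnion₂.1 (hs (mem_univ x))
  exact ⟨y, hy, hxy⟩

end Net

/-! ### Approximation on a net and density. -/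

section Approximation

variable {n : ℕ} {M : Type*} [TopologicalSpace M] [ChartedSpace (EuclideanSpace ℝ (Fin n)) M]
  [IsManifold (𝓡 n) ∞ M] [T2Space M] [CompactSpace M] [ConnectedSpace M]

theorem exists_near_minimal_path {g h : RiemMetric n M} {C : ℝ} (hC : 0 < C)
    (H : ∀ x v, gnorm h x v ≤ C * gnorm g x v) {ε : ℝ} (hε : 0 < ε) (p q : M) :
    ∃ (γ : ℝ → M) (S : Set (Set M × ℝ)), γ 0 = p ∧ γ 1 = q ∧ ContMDiff 𝓘(ℝ, ℝ) (𝓡 n) 1 γ ∧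
      length h γ 0 1 ≤ riemEDist h p q + ENNReal.ofReal ε ∧ S.Finite ∧
      (∀ i ∈ S, IsRatio g h i.1 i.2) ∧
      ∀ t ∈ Icc (0 : ℝ) 1, ∃ i ∈ S, γ t ∈ i.1 ∧ i.2 * speed g γ t ≤ speed h γ t + ε := by
  obtain ⟨γ, h0, h1, hγ, hl⟩ := exists_length_lt h (ENNReal.lt_add_right (riemEDist_ne_top h p q)
    (ENNReal.ofReal_pos.2 hε).ne')
  obtain ⟨S, hS, hS1, hS2⟩ := exists_path_isRatio hC H hγ hε
  exact ⟨γ, S, h0, h1, hγ, hl.le, hS, hS1, hS2⟩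

/-- Some metric conformal to `g` approximates the distance of `h` on a finite set, and is controlled
by `C ^ 2 g`. -/
theorem exists_isConformal_approx {g h : RiemMetric n M} {C : ℝ} (hC : 0 < C)
    (H : ∀ x v, gnorm h x v ≤ C * gnorm g x v) {ε : ℝ} (hε : 0 < ε) {s : Set M} (hs : s.Finite) :
    ∃ g' : RiemMetric n M, IsConformal g g' ∧ (∀ x v, gnorm g' x v ≤ C * gnorm g x v) ∧
      (∀ p q, riemEDist h p q ≤ riemEDist g' p q + ENNReal.ofReal ε) ∧
      ∀ p ∈ s, ∀ q ∈ s, riemEDist g' p q ≤ riemEDist h p q + ENNReal.ofReal (2 * ε) := by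
  classical
  choose γ S h0 h1 hγ hl hfin hratio hcov using exists_near_minimal_path hC H hε
  -- Adding the pair `(univ, C)` makes the sets cover `M` and forces `w ≤ C`.
  have hTfin : ((⋃ p ∈ s, ⋃ q ∈ s, S p q) ∪ {((univ : Set M), C)}).Finite :=
    (hs.biUnion fun p _ => hs.biUnion fun q _ => hfin p q).union (finite_singleton _)
  obtain ⟨T, hT⟩ := hTfin.exists_finset
  have hTS : ∀ p ∈ s, ∀ q ∈ s, ∀ i ∈ S p q, i ∈ T := fun p hp q hq i hi =>
    (hT i).2 (.inl (mem_biUnion hp (mem_biUnion hq hi)))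
  have hTC : ((univ : Set M), C) ∈ T := (hT _).2 (.inr rfl)
  have hTr : ∀ i ∈ T, IsRatio g h i.1 i.2 := by
    intro i hi
    rcases (hT i).1 hi with hi | rfl
    · simp only [mem_iUnion] at hi
      obtain ⟨p, -, q, -, hi⟩ := hi
      exact hratio p q i hi
    · exact ⟨isClosed_univ, hC, fun y _ z _ => riemEDist_le_mul hC H y z⟩
  -- Chosen so that the error `3 ^ T.card * τ` of `riemEDist_le_length_add` is exactly `ε`.
  set τ : ℝ≥0∞ := ENNReal.ofReal ε / 3 ^ T.card with hτ
  have hτ0 : τ ≠ 0 := (ENNReal.div_pos (ENNReal.ofReal_pos.2 hε).ne' (by simp)).ne'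
  have hτε : 3 ^ T.card * τ = ENNReal.ofReal ε := ENNReal.mul_div_cancel (by simp) (by simp)
  have hA : ∀ i : Set M × ℝ, ∃ A : Set M, i ∈ T → IsClosed A ∧ i.1 ⊆ interior A ∧
      ∀ y ∈ A, ∀ z ∈ A, riemEDist h y z ≤ ENNReal.ofReal i.2 * riemEDist g y z + τ := by
    intro i
    by_cases hi : i ∈ T
    · obtain ⟨A, hA⟩ := (hTr i hi).exists_closed_nhds hτ0
      exact ⟨A, fun _ => hA⟩
    · exact ⟨∅, fun hi' => absurd hi' hi⟩
  choose A hA using hA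
  obtain ⟨w, hw, hwlow, hwup⟩ := exists_smooth_weight (n := n) T (K := Prod.fst) (A := A)
    (ρ := Prod.snd) (fun i hi => (hTr i hi).1) (fun i hi => (hA i hi).2.1)
    (fun x => ⟨_, hTC, mem_univ x⟩)
  have hpos : ∀ x, 0 < w x := fun x => by
    obtain ⟨i, hi, -, hi'⟩ := hwlow x
    exact (hTr i hi).2.1.trans_le hi'
  have hspeed : ∀ (σ : ℝ → M) (t : ℝ), speed (sqScale g w hw hpos) σ t = w (σ t) * speed g σ t :=
    fun σ t => gnorm_sqScale g hw hpos _ _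
  refine ⟨sqScale g w hw hpos, isConformal_sqScale g hw hpos, fun x v => ?_, fun p q => ?_,
    fun p hp q hq => ?_⟩
  · rw [gnorm_sqScale]
    exact mul_le_mul_of_nonneg_right (hwup x _ hTC (mem_univ x)) (gnorm_nonneg _ _ _)
  · refine le_of_forall_gt fun r hr => ?_
    obtain ⟨r', hr', hr''⟩ : ∃ r', riemEDist (sqScale g w hw hpos) p q < r' ∧
        r' + ENNReal.ofReal ε ≤ r := by
      refine ⟨r - ENNReal.ofReal ε, lt_tsub_iff_right.2 hr, ?_⟩
      rw [tsub_add_cancel_of_le (le_add_self.trans hr.le)]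
    obtain ⟨σ, rfl, rfl, hσ, hσl⟩ := exists_length_lt _ hr'
    refine (riemEDist_le_length_add (g' := sqScale g w hw hpos) T (fun i hi => (hA i hi).1)
      (fun i hi => (hTr i hi).2.1.le)
      (fun i hi => (hA i hi).2.2) hσ zero_le_one fun t _ => ?_).trans_lt
        (lt_of_lt_of_le ?_ hr'')
    · obtain ⟨i, hi, hi1, hi2⟩ := hwlow (σ t)
      refine ⟨i, hi, hi1, ?_⟩
      rw [hspeed]
      exact mul_le_mul_of_nonneg_right hi2 (speed_nonneg _ _ _)
    · rw [hτε]
      exact ENNReal.add_lt_add_right ENNReal.ofReal_ne_top hσl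
  -- On the chosen path `w ≤ ρ i`, so the new speed exceeds the `h`-speed by at most `ε` over a unit
  -- time. The second `ε` in the bound comes from the path being only almost minimal.
  · have h2 : length (sqScale g w hw hpos) (γ p q) 0 1 ≤ length h (γ p q) 0 1 +
        ENNReal.ofReal ε := by
      have : ENNReal.ofReal ε = ∫⁻ _ in Icc (0 : ℝ) 1, ENNReal.ofReal ε := by simp
      rw [length, length, this, ← lintegral_add_right _ measurable_const]
      refine setLIntegral_mono' measurableSet_Icc fun t ht => ?_
      rw [← ENNReal.ofReal_add (speed_nonneg _ _ _) hε.le, hspeed]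
      obtain ⟨i, hi, hi1, hi2⟩ := hcov p q t ht
      exact ENNReal.ofReal_le_ofReal ((mul_le_mul_of_nonneg_right
        (hwup _ i (hTS p hp q hq i hi) hi1) (speed_nonneg _ _ _)).trans hi2)
    have h3 := riemEDist_le_length (sqScale g w hw hpos) (hγ p q) zero_le_one
    rw [h0, h1] at h3
    refine (h3.trans (h2.trans (add_le_add_left (hl p q) _))).trans_eq ?_
    rw [add_assoc, ← ENNReal.ofReal_add hε.le hε.le, two_mul]

/-- The identity of `s` is an almost isometry between nets of the two spaces. -/
theorem dist_mk_le_of_net {g h : RiemMetric n M} {s : Set M} {ε₁ ε₂ : ℝ} (h1 : 0 ≤ ε₁)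
    (h2 : 0 ≤ ε₂)
    (hg : ∀ x, ∃ y ∈ s, riemEDist g x y ≤ ENNReal.ofReal ε₁)
    (hh : ∀ x, ∃ y ∈ s, riemEDist h x y ≤ ENNReal.ofReal ε₁)
    (hgh : ∀ p ∈ s, ∀ q ∈ s, riemEDist g p q ≤ riemEDist h p q + ENNReal.ofReal ε₂)
    (hhg : ∀ p ∈ s, ∀ q ∈ s, riemEDist h p q ≤ riemEDist g p q + ENNReal.ofReal ε₂) :
    dist (ModuliSpace.mk h) (ModuliSpace.mk g) ≤ ε₁ + ε₂ / 2 + ε₁ := by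
  have key : ∀ {g h : RiemMetric n M} {p q : M},
      riemEDist g p q ≤ riemEDist h p q + ENNReal.ofReal ε₂ →
        (riemEDist g p q).toReal ≤ (riemEDist h p q).toReal + ε₂ := fun {g h p q} H => by
    rw [← ENNReal.toReal_ofReal h2, ← ENNReal.toReal_add (riemEDist_ne_top h p q)
      ENNReal.ofReal_ne_top]
    exact ENNReal.toReal_mono (ENNReal.add_ne_top.2
      ⟨riemEDist_ne_top h p q, ENNReal.ofReal_ne_top⟩) H
  rw [ModuliSpace.dist_mk]
  refine @GromovHausdorff.ghDist_le_of_approx_subsets M (riemMetricSpace h)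
    (compactSpace_riemMetricSpace h) _ M (riemMetricSpace g) (compactSpace_riemMetricSpace g) _
    s Subtype.val ε₁ ε₂ ε₁ (fun x => ?_) (fun x => ?_) (fun p q => ?_)
  · obtain ⟨y, hy, hxy⟩ := hh x
    exact ⟨y, hy, ENNReal.toReal_le_of_le_ofReal h1 hxy⟩
  · obtain ⟨y, hy, hxy⟩ := hg x
    exact ⟨⟨y, hy⟩, ENNReal.toReal_le_of_le_ofReal h1 hxy⟩
  · change |(riemEDist h p q).toReal - (riemEDist g p q).toReal| ≤ ε₂
    rw [abs_sub_le_iff]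
    have h3 := key (hgh p p.2 q q.2)
    have h4 := key (hhg p p.2 q q.2)
    constructor <;> linarith

theorem dense_conformalClass (g : RiemMetric n M) : Dense (conformalClass g) := by
  intro x
  obtain ⟨h, rfl⟩ : ∃ h, ModuliSpace.mk h = x := Quotient.exists_rep x
  refine Metric.mem_closure_iff.2 fun ε hε => ?_
  obtain ⟨C, hC, H⟩ := exists_gnorm_le_mul g h
  have hδ : 0 < ε / 4 := by positivity
  -- At scale `(ε / 4) / C` for `g`, the set is an `ε / 4`-net for every metric with norm at most
  -- `C` times that of `g`, in particular for both `h` and `g'`. The total is then `ε / 4 + ε / 4 +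
  -- ε / 4 < ε`.
  obtain ⟨s, hs, hnet⟩ := exists_finite_net g
    (ENNReal.ofReal_pos.2 (div_pos hδ hC))
  obtain ⟨g', hconf, H', hlow, hup⟩ := exists_isConformal_approx hC H hδ hs
  have hnet' : ∀ k : RiemMetric n M, (∀ x v, gnorm k x v ≤ C * gnorm g x v) →
      ∀ x, ∃ y ∈ s, riemEDist k x y ≤ ENNReal.ofReal (ε / 4) := fun k hk x => by
    obtain ⟨y, hy, hxy⟩ := hnet x
    refine ⟨y, hy, (riemEDist_le_mul hC hk x y).trans ((mul_le_mul_right hxy.le _).trans_eq ?_)⟩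
    rw [← ENNReal.ofReal_mul hC.le, mul_div_cancel₀ _ hC.ne']
  refine ⟨_, ⟨g', hconf, rfl⟩, ?_⟩
  refine (dist_mk_le_of_net (ε₂ := 2 * (ε / 4)) hδ.le (by positivity) (hnet' g' H') (hnet' h H) hup
    fun p _ q _ => (hlow p q).trans ?_).trans_lt (by linarith)
  gcongr
  linarith

end Approximation

end ConformalDensity

end

theorem mainTheorem1 (n : ℕ) (M : Type*) [TopologicalSpace M]
    [ChartedSpace (EuclideanSpace ℝ (Fin n)) M] [IsManifold (𝓡 n) ∞ M]
    [T2Space M] [CompactSpace M] [ConnectedSpace M] (g : ConformalDensity.RiemMetric n M) :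
    Dense (ConformalDensity.conformalClass g) := by
  exact ConformalDensity.dense_conformalClass g
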